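/- Let $n,m,M\in\mathbb N$, $\mathrm U\subset\mathbb R^m$, $\Gamma_1,\dots,\Gamma_M\in\mathbb R^{n\times n}$, $B\in\mathbb R^{n\times m}$, and consider the (identified) model $$\dot x(t)=\sum_{j=1}^M\Gamma_j f_j(x(t))+Bu(t),\qquad t\ge 0,\ u(t)\in \mathrm U,\tag{1}$$ where $f_j(x)=(f_j^1(x_1),\dots,f_j^n(x_n))^\top$ with continuous functions $f_j^i:\mathbb R\to\mathbb R$ satisfying the sector condition $\nu f_j^i(\nu)>0$ for all $\nu\ne0$, $1\le i\le n$, $1\le j\le M$. Let $1\le\varphi\le\mu\le M$ be indices such that $\lim_{\nu\to\pm\infty}f_a^i(\nu)=\pm\infty$ for all $1\le a\le\varphi$, $1\le i\le n$, and $\lim_{\nu\to\pm\infty}\int_0^\nu f_b^i(\tau)\,d\tau=+\infty$ for all $1\le b\le\mu$, $1\le i\le n$. The admissible inputs are the continuously differentiable $u:[0,\infty)\to \mathrm U$ with $\sup_{t\ge0}\|u(t)\|+\sup_{t\ge0}\|\dot u(t)\|<\infty$; put $\|u\|_\infty=\sup_{t\ge0}\|u(t)\|$, where $\|\cdot\|$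 is the Euclidean norm. System (1) is forward complete if for every $x_0\in\mathbb R^n$ and every admissible $u$ it has a unique solution $x(\cdot,x_0,u)$ on $[0,\infty)$ with $x(0,x_0,u)=x_0$. A forward complete system (1) is input-to-state stable (ISS) if there are $\beta\in\mathcal{KL}$ and $\gamma\in\mathcal K$ such that $\|x(t,x_0,u)\|\le\beta(\|x_0\|,t)+\gamma(\|u\|_\infty)$ for all $t\ge0$, $x_0\in\mathbb R^n$ and admissible $u$. Here $\gamma\in\mathcal K$ means that $\gamma:[0,\infty)\to[0,\infty)$ is continuous and strictly increasing with $\gamma(0)=0$, and $\beta\in\mathcal{KL}$ means that $\beta(\cdot,t)\in\mathcal K$ for each $t\ge0$ and that $\beta(r,\cdot)$ is nonincreasing with limit $0$ at infinity for each $r\ge0$. **Theorem.** Suppose that there exist a symmetric positive semidefinite $P\in\mathbb R^{n\times n}$, diagonal matrices with nonnegative diagonal entries $\Lambda^j,\Xi^j\in\mathbb R^{n\times n}$ ($1\le j\le M$) and $\Upsilon_{s,z}\in\mathbb R^{n\times n}$ ($0\le s<z\le M$), a symmetric positive definite $\Phi\in\mathbb R^{n\times n}$ and $\rho\in\mathbb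 R$ such that $$P+\rho\sum_{j=1}^{\mu}\Lambda^j>0,\qquad Q\le0,\qquad \sum_{k=1}^{\varphi}\Xi^k+2\sum_{s=0}^{\varphi}\sum_{z=s+1}^{\varphi}\Upsilon_{s,z}>0,$$ where $Q=Q^\top=(Q_{a,b})_{a,b=1}^{M+2}$ is the symmetric block matrix with $n\times n$ blocks $$Q_{1,1}=0,\quad Q_{1,j+1}=P\Gamma_j+\Upsilon_{0,j},\quad Q_{1,M+2}=P,\quad Q_{j+1,j+1}=\Gamma_j^\top\Lambda^j+\Lambda^j\Gamma_j+\Xi^j,$$ $$Q_{j+1,M+2}=\Lambda^j,\quad Q_{M+2,M+2}=-\Phi\qquad(1\le j\le M),$$ $$Q_{s+1,z+1}=\Gamma_s^\top\Lambda^z+\Lambda^s\Gamma_z+\Upsilon_{s,z}\qquad(1\le s<z\le M).$$ If system (1) is forward complete, then it is ISS. -/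

import Mathlib

open Set Filter Topology

noncomputable section

/-- Comparison functions of class `𝒦` on `[0, ∞)`: continuous, strictly increasing, zero at zero.
Only the values on `[0, ∞)` matter. -/
structure IsClassK (γ : ℝ → ℝ) : Prop where
  continuousOn : ContinuousOn γ (Ici 0)
  strictMonoOn : StrictMonoOn γ (Ici 0)
  map_zero : γ 0 = 0

/-- Comparison functions of class `𝒦ℒ` on `[0, ∞) × [0, ∞)`: of class `𝒦` in the first argument,
and decreasing to zero in the second one. -/
structure IsClassKL (β : ℝ → ℝ → ℝ) : Prop where
  classK : ∀ t, 0 ≤ t → IsClassK (fun r => β r t)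
  antitoneOn : ∀ r, 0 ≤ r → AntitoneOn (β r) (Ici 0)
  tendsto_zero : ∀ r, 0 ≤ r → Tendsto (β r) atTop (𝓝 0)

variable {n m M : ℕ}

/-- The admissible inputs: `u : [0, ∞) → U` continuously differentiable with
`sup ‖u‖ + sup ‖u'‖ < ∞`. Only the values on `[0, ∞)` matter. -/
structure IsAdmissibleInput (U : Set (EuclideanSpace ℝ (Fin m)))
    (u : ℝ → EuclideanSpace ℝ (Fin m)) : Prop where
  mem : ∀ t, 0 ≤ t → u t ∈ U
  contDiffOn : ContDiffOn ℝ 1 u (Ici 0)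
  bounded : ∃ C : ℝ, ∀ t, 0 ≤ t → ‖u t‖ ≤ C
  bounded_deriv : ∃ C : ℝ, ∀ t, 0 ≤ t → ‖derivWithin u (Ici 0) t‖ ≤ C

/-- `‖u‖_∞ = sup_{t ≥ 0} ‖u(t)‖` (a genuine supremum for admissible inputs). -/
def inputSupNorm (u : ℝ → EuclideanSpace ℝ (Fin m)) : ℝ :=
  ⨆ t : Ici (0 : ℝ), ‖u t‖

/-- `x` solves `ẋ(t) = F(x(t), u(t))` on `[0, ∞)` with `x(0) = x₀`
(one-sided derivative at `t = 0`). -/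
structure IsSolution (F : EuclideanSpace ℝ (Fin n) → EuclideanSpace ℝ (Fin m) →
      EuclideanSpace ℝ (Fin n))
    (x₀ : EuclideanSpace ℝ (Fin n)) (u : ℝ → EuclideanSpace ℝ (Fin m))
    (x : ℝ → EuclideanSpace ℝ (Fin n)) : Prop where
  init : x 0 = x₀
  deriv : ∀ t, 0 ≤ t → HasDerivWithinAt x (F (x t) (u t)) (Ici 0) t

/-- Forward completeness: for each initial state and each admissible input with values in `U`,
there is a solution on all of `[0, ∞)`, and it is unique there. -/
def ForwardComplete (U : Set (EuclideanSpace ℝ (Fin m)))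
    (F : EuclideanSpace ℝ (Fin n) → EuclideanSpace ℝ (Fin m) → EuclideanSpace ℝ (Fin n)) : Prop :=
  ∀ x₀ u, IsAdmissibleInput U u →
    ∃ x, IsSolution F x₀ u x ∧ ∀ y, IsSolution F x₀ u y → EqOn y x (Ici 0)

/-- Input-to-state stability of `ẋ = F(x, u)`, `u(t) ∈ U`: the system is forward complete and
`‖x(t, x₀, u)‖ ≤ β(‖x₀‖, t) + γ(‖u‖_∞)` for some `β ∈ 𝒦ℒ` and `γ ∈ 𝒦`. -/
def IsISS (U : Set (EuclideanSpace ℝ (Fin m)))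
    (F : EuclideanSpace ℝ (Fin n) → EuclideanSpace ℝ (Fin m) → EuclideanSpace ℝ (Fin n)) : Prop :=
  ForwardComplete U F ∧
    ∃ (β : ℝ → ℝ → ℝ) (γ : ℝ → ℝ), IsClassKL β ∧ IsClassK γ ∧
      ∀ x₀ u, IsAdmissibleInput U u → ∀ x, IsSolution F x₀ u x →
        ∀ t, 0 ≤ t → ‖x t‖ ≤ β ‖x₀‖ t + γ (inputSupNorm u)

/-- The right-hand side `F(x, u) = ∑ⱼ Γⱼ fⱼ(x) + B u` of the identified model, with the diagonal
nonlinearities `fⱼ(x) = (fⱼ¹(x₁), …, fⱼⁿ(xₙ))`. The index `j : Fin M` stands for `j + 1 ∈ {1, …, M}`. -/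
def identifiedField (Γ : Fin M → Matrix (Fin n) (Fin n) ℝ) (f : Fin M → Fin n → ℝ → ℝ)
    (B : Matrix (Fin n) (Fin m) ℝ)
    (x : EuclideanSpace ℝ (Fin n)) (u : EuclideanSpace ℝ (Fin m)) : EuclideanSpace ℝ (Fin n) :=
  WithLp.toLp 2 (∑ j, (Γ j).mulVec (fun i => f j i (x i)) + B.mulVec u.ofLp)

/-- The sector condition: the `fⱼⁱ` are continuous and `ν fⱼⁱ(ν) > 0` for `ν ≠ 0`. -/
structure IsSectorFamily (f : Fin M → Fin n → ℝ → ℝ) : Prop where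
  continuous : ∀ j i, Continuous (f j i)
  sector : ∀ j i ν, ν ≠ 0 → 0 < ν * f j i ν

/-- `φ ≤ μ ≤ M` are such that the first `φ` nonlinearities tend to `±∞` at `±∞`, and the integrals
of the first `μ` nonlinearities tend to `+∞` at `±∞`. -/
structure IsGrowthIndices (f : Fin M → Fin n → ℝ → ℝ) (φ μ : ℕ) : Prop where
  le_mu : φ ≤ μ
  mu_le : μ ≤ M
  tendsto_atTop : ∀ j : Fin M, (j : ℕ) < φ → ∀ i, Tendsto (f j i) atTop atTop
  tendsto_atBot : ∀ j : Fin M, (j : ℕ) < φ → ∀ i, Tendsto (f j i) atBot atBot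
  integral_atTop : ∀ j : Fin M, (j : ℕ) < μ → ∀ i,
    Tendsto (fun ν => ∫ τ in (0 : ℝ)..ν, f j i τ) atTop atTop
  integral_atBot : ∀ j : Fin M, (j : ℕ) < μ → ∀ i,
    Tendsto (fun ν => ∫ τ in (0 : ℝ)..ν, f j i τ) atBot atTop

/-- The `(M + 2) × (M + 2)` blocks, each of size `n × n`, of the symmetric matrix `Q`. The block
index `inl ()` stands for `1`, `inr (inl j)` for `j + 1` where `j` runs over `{1, …, M}`, and
`inr (inr ())` for `M + 2`. Diagonal matrices are given by their diagonals; `Υ s z` is indexed by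
`s, z ∈ {0, …, M}`, and only its entries with `s < z` are used. -/
def lmiBlock (P : Matrix (Fin n) (Fin n) ℝ) (Γ : Fin M → Matrix (Fin n) (Fin n) ℝ)
    (Λ Ξ : Fin M → Fin n → ℝ) (Υ : Fin (M + 1) → Fin (M + 1) → Fin n → ℝ)
    (Φ : Matrix (Fin n) (Fin n) ℝ) :
    Unit ⊕ Fin M ⊕ Unit → Unit ⊕ Fin M ⊕ Unit → Matrix (Fin n) (Fin n) ℝ
  | .inl _, .inl _ => 0
  | .inl _, .inr (.inl j) => P * Γ j + Matrix.diagonal (Υ 0 j.succ)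
  | .inl _, .inr (.inr _) => P
  | .inr (.inl j), .inl _ => (P * Γ j + Matrix.diagonal (Υ 0 j.succ)).transpose
  | .inr (.inl s), .inr (.inl z) =>
      if s = z then
        (Γ s).transpose * Matrix.diagonal (Λ s) + Matrix.diagonal (Λ s) * Γ s
          + Matrix.diagonal (Ξ s)
      else if s < z then
        (Γ s).transpose * Matrix.diagonal (Λ z) + Matrix.diagonal (Λ s) * Γ z
          + Matrix.diagonal (Υ s.succ z.succ)
      else
        ((Γ z).transpose * Matrix.diagonal (Λ s) + Matrix.diagonal (Λ z) * Γ s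
          + Matrix.diagonal (Υ z.succ s.succ)).transpose
  | .inr (.inl j), .inr (.inr _) => Matrix.diagonal (Λ j)
  | .inr (.inr _), .inl _ => P.transpose
  | .inr (.inr _), .inr (.inl j) => (Matrix.diagonal (Λ j)).transpose
  | .inr (.inr _), .inr (.inr _) => -Φ

/-- The matrix `Q ∈ ℝ^{(M + 2) n × (M + 2) n}` assembled from its blocks. -/
def lmiMatrix (P : Matrix (Fin n) (Fin n) ℝ) (Γ : Fin M → Matrix (Fin n) (Fin n) ℝ)
    (Λ Ξ : Fin M → Fin n → ℝ) (Υ : Fin (M + 1) → Fin (M + 1) → Fin n → ℝ)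
    (Φ : Matrix (Fin n) (Fin n) ℝ) :
    Matrix ((Unit ⊕ Fin M ⊕ Unit) × Fin n) ((Unit ⊕ Fin M ⊕ Unit) × Fin n) ℝ :=
  Matrix.of fun a b => lmiBlock P Γ Λ Ξ Υ Φ a.1 b.1 a.2 b.2

/-- `(P, Λ, Ξ, Υ, Φ, ρ)` is a solution of the linear matrix inequalities. -/
structure IsLMISolution (Γ : Fin M → Matrix (Fin n) (Fin n) ℝ) (φ μ : ℕ)
    (P : Matrix (Fin n) (Fin n) ℝ) (Λ Ξ : Fin M → Fin n → ℝ)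
    (Υ : Fin (M + 1) → Fin (M + 1) → Fin n → ℝ) (Φ : Matrix (Fin n) (Fin n) ℝ) (ρ : ℝ) : Prop where
  P_nonneg : P.PosSemidef
  Λ_nonneg : ∀ j i, 0 ≤ Λ j i
  Ξ_nonneg : ∀ j i, 0 ≤ Ξ j i
  Υ_nonneg : ∀ s z, s < z → ∀ i, 0 ≤ Υ s z i
  Φ_pos : Φ.PosDef
  lmi_pos : (P + ρ • ∑ j : Fin M with j.val < μ, Matrix.diagonal (Λ j)).PosDef
  lmi_Q : (-lmiMatrix P Γ Λ Ξ Υ Φ).PosSemidef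
  lmi_sum : ((∑ k : Fin M with k.val < φ, Matrix.diagonal (Ξ k))
    + (2 : ℝ) • ∑ s : Fin (M + 1) with s.val ≤ φ,
        ∑ z : Fin (M + 1) with s < z ∧ z.val ≤ φ, Matrix.diagonal (Υ s z)).PosDef

end

/-!
The function `V x = xᵀ P x + 2 ∑ⱼ ∑ᵢ Λʲᵢ ∫₀^{xᵢ} fⱼⁱ` (`lureFunction`) is a Lyapunov function in
dissipation form. Along a solution, `V'` is `2 xᵀ P ẋ + 2 ∑ⱼ fⱼ(x)ᵀ Λʲ ẋ`. Evaluating `Q ≤ 0` at the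
vector `(x, f₁(x), …, f_M(x), B u)` turns this into `V' ≤ -W(x) + (B u)ᵀ Φ (B u)`
(`IsLMISolution.lure_dissipation`), where `W(x) = ∑ᵢ wᵢ(xᵢ)` collects the multiplier terms
`Ξʲᵢ fⱼⁱ(xᵢ)²` and `2 Υ_{s,z} f_sⁱ(xᵢ) f_zⁱ(xᵢ)`, with `f₀` the identity (`dissipationCoord`). By the
sector condition all of these are nonnegative.

Both `V` and `W` are positive definite with bounded sublevel sets. For `W`, the LMI on `Ξ` and `Υ`
gives each coordinate a positive multiple of a product of two nonlinearities that tend to `±∞` at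
`±∞`. For `V`, the integrals bound every coordinate that carries a positive weight `Λʲᵢ` with
`j ≤ μ`, hence they bound `xᵀ (∑ Λʲ) x`, and the quadratic form of `P + ρ ∑ Λʲ` bounds the rest.

From the dissipation inequality, input-to-state stability follows by comparison functions
(`exists_iss_estimate_of_dissipation`). There are `α, α₁ ∈ 𝒦∞` with `α(V) ≤ W`, `α s ≤ s` and
`α₁(‖x‖) ≤ V(x)`. They are built as infimal convolutions. The rescaling `κ` with `κ' = 2 κ / α` is
of class `𝒦∞` because `α s ≤ s`. If `d` bounds the supply, then as long as `α(V) > 2 d`, the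
inequality `V' ≤ -α(V) / 2` makes `eᵗ κ(V)` nonincreasing; once `α(V) ≤ 2 d`, this persists.
Inverting `α`, `κ` and `α₁` gives `γ` and `β` explicitly. The estimate is about given solution curves,
so it uses no property of the differential equation beyond the dissipation inequality.
-/

/-! ### Comparison functions -/

/-- Class `𝒦∞`: class `𝒦` and unbounded. -/
structure IsClassKInfty (θ : ℝ → ℝ) : Prop extends IsClassK θ where
  tendsto_atTop : Tendsto θ atTop atTop

theorem IsClassK.nonneg {θ : ℝ → ℝ} (h : IsClassK θ) {r : ℝ} (hr : 0 ≤ r) : 0 ≤ θ r := by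
  rw [← h.map_zero]
  exact h.strictMonoOn.monotoneOn self_mem_Ici hr hr

theorem IsClassK.pos {θ : ℝ → ℝ} (h : IsClassK θ) {r : ℝ} (hr : 0 < r) : 0 < θ r := by
  rw [← h.map_zero]
  exact h.strictMonoOn self_mem_Ici hr.le hr

theorem IsClassK.mono {θ : ℝ → ℝ} (h : IsClassK θ) {r s : ℝ} (hr : 0 ≤ r) (hrs : r ≤ s) :
    θ r ≤ θ s :=
  h.strictMonoOn.monotoneOn hr (hr.trans hrs) hrs

theorem IsClassK.comp {θ ω : ℝ → ℝ} (hθ : IsClassK θ) (hω : IsClassK ω) :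
    IsClassK fun r => θ (ω r) where
  continuousOn := hθ.continuousOn.comp hω.continuousOn fun _ hr => hω.nonneg hr
  strictMonoOn := hθ.strictMonoOn.comp hω.strictMonoOn fun _ hr => hω.nonneg hr
  map_zero := by rw [hω.map_zero, hθ.map_zero]

theorem IsClassK.const_mul {θ : ℝ → ℝ} (hθ : IsClassK θ) {c : ℝ} (hc : 0 < c) :
    IsClassK fun r => c * θ r where
  continuousOn := continuousOn_const.mul hθ.continuousOn
  strictMonoOn := fun _ hr _ hs hrs => mul_lt_mul_of_pos_left (hθ.strictMonoOn hr hs hrs) hc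
  map_zero := by rw [hθ.map_zero, mul_zero]

theorem IsClassKInfty.exists_inverse {θ : ℝ → ℝ} (h : IsClassKInfty θ) :
    ∃ ω, IsClassK ω ∧ (∀ s, 0 ≤ s → θ (ω s) = s) ∧ ∀ r, 0 ≤ r → ω (θ r) = r := by
  -- The extension of `θ` by the identity to the negative half-line is an order isomorphism of `ℝ`.
  let g : ℝ → ℝ := fun s => θ (max s 0) + min s 0
  have hgp : ∀ s, 0 ≤ s → g s = θ s := fun s hs => by simp [g, hs]
  have hgc : Continuous g :=
    (h.continuousOn.comp_continuous (by fun_prop) fun s => le_max_right s 0).add (by fun_prop)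
  have hgm : StrictMono g := by
    intro s t hst
    rcases le_or_gt t 0 with ht | ht
    · simp only [g, max_eq_right ht, max_eq_right (hst.le.trans ht), min_eq_left ht,
        min_eq_left (hst.le.trans ht)]
      linarith
    · have h1 : θ (max s 0) < θ (max t 0) :=
        h.strictMonoOn (le_max_right s 0) (le_max_right t 0)
          (max_lt (hst.trans_le (le_max_left _ _)) (lt_max_of_lt_left ht))
      have h2 : min s 0 ≤ min t 0 := min_le_min_right 0 hst.le
      simp only [g]
      linarith
  have htop : Tendsto g atTop atTop :=
    h.tendsto_atTop.congr' ((eventually_ge_atTop 0).mono fun s hs => (hgp s hs).symm)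
  have hbot : Tendsto g atBot atBot := by
    refine tendsto_id.congr' ((eventually_le_atBot 0).mono fun s hs => ?_)
    simp [g, hs, h.map_zero]
  let e := hgm.orderIsoOfSurjective g (hgc.surjective htop hbot)
  have he : ∀ s, e s = g s := fun _ => rfl
  have hes : ∀ r, 0 ≤ r → e.symm (θ r) = r := fun r hr => by
    rw [← hgp r hr, ← he, e.symm_apply_apply]
  have h0 : e.symm 0 = 0 := by simpa [h.map_zero] using hes 0 le_rfl
  refine ⟨e.symm, ⟨e.symm.continuous.continuousOn, e.symm.strictMono.strictMonoOn _, h0⟩, ?_, hes⟩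
  intro s hs
  have : 0 ≤ e.symm s := by rw [← h0]; exact e.symm.monotone hs
  rw [← hgp _ this, ← he, e.apply_symm_apply]

/-! ### Proper positive definite functions and their comparison functions -/

section
variable {E : Type*} [NormedAddCommGroup E]

/-- Continuous functions that vanish at the origin, are positive elsewhere, and have bounded
sublevel sets. -/
structure IsProperPosDef (W : E → ℝ) : Prop where
  continuous : Continuous W
  map_zero : W 0 = 0
  pos : ∀ x, x ≠ 0 → 0 < W x
  bounded_sublevel : ∀ R, ∃ C, ∀ x, W x ≤ R → ‖x‖ ≤ C

theorem IsProperPosDef.nonneg {W : E → ℝ} (h : IsProperPosDef W) (x : E) : 0 ≤ W x := by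
  rcases eq_or_ne x 0 with rfl | hx
  exacts [h.map_zero.ge, (h.pos x hx).le]

/-- A continuous `g` vanishing at the origin is dominated by a proper positive definite `W` up to a
`𝒦∞` function: the infimal convolution `s ↦ inf_x (W x + max 0 (s - g x))` is 1-Lipschitz,
nondecreasing, positive for `s > 0` and at most `W x` at `s = g x`. The factor `s / (1 + s)` makes it
strictly increasing. -/
theorem IsProperPosDef.exists_classKInfty_comp_le [ProperSpace E] {W g : E → ℝ}
    (hW : IsProperPosDef W) (hg : Continuous g) (hg0 : g 0 = 0) :
    ∃ α, IsClassKInfty α ∧ (∀ s, 0 ≤ s → α s ≤ s) ∧ ∀ x, 0 ≤ g x → α (g x) ≤ W x := by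
  let h : ℝ → E → ℝ := fun s x => W x + max 0 (s - g x)
  let a : ℝ → ℝ := fun s => ⨅ x, h s x
  have hnn : ∀ s x, 0 ≤ h s x := fun s x => add_nonneg (hW.nonneg x) (le_max_left _ _)
  have hbdd : ∀ s, BddBelow (range (h s)) := fun s => ⟨0, by rintro _ ⟨x, rfl⟩; exact hnn s x⟩
  have hle : ∀ s x, a s ≤ h s x := fun s x => ciInf_le (hbdd s) x
  have ha0 : ∀ s, 0 ≤ s → a s ≤ s := fun s hs => by
    simpa [h, hW.map_zero, hg0, hs] using hle s 0
  have hmono : Monotone a := fun s t hst =>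
    le_ciInf fun x => (hle s x).trans (by simp only [h]; gcongr)
  have hlip : ∀ s t, s ≤ t → a t ≤ a s + (t - s) := fun s t hst => by
    rw [← sub_le_iff_le_add]
    refine le_ciInf fun x => ?_
    have h1 := hle t x
    have h2 : max 0 (t - g x) ≤ max 0 (s - g x) + (t - s) :=
      max_le (add_nonneg (le_max_left _ _) (by linarith)) (by linarith [le_max_right 0 (s - g x)])
    simp only [h] at h1 ⊢
    linarith
  have hcont : Continuous a := by
    refine (LipschitzWith.of_le_add fun s t => ?_).continuous
    rcases le_total s t with hst | hst
    · exact (hmono hst).trans (le_add_of_nonneg_right dist_nonneg)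
    · simpa [Real.dist_eq, abs_of_nonneg (sub_nonneg.2 hst)] using hlip t s hst
  have hpos : ∀ s, 0 < s → 0 < a s := by
    intro s hs
    obtain ⟨C, hC⟩ := hW.bounded_sublevel s
    have hC0 : 0 ≤ C := (norm_nonneg _).trans (hC 0 (hW.map_zero.le.trans hs.le))
    obtain ⟨y, -, hy⟩ := (isCompact_closedBall (0 : E) C).exists_isMinOn
      ⟨0, by simpa using hC0⟩
      (f := h s) (by have := hW.continuous; exact Continuous.continuousOn (by fun_prop))
    have hyp : 0 < h s y := by
      rcases eq_or_ne y 0 with rfl | hy0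
      · simpa [h, hW.map_zero, hg0] using hs
      · exact add_pos_of_pos_of_nonneg (hW.pos y hy0) (le_max_left _ _)
    refine hyp.trans_le (le_ciInf fun x => ?_)
    rcases le_or_gt (W x) s with hx | hx
    · exact hy (by simpa using hC x hx)
    · have h0 : h s y ≤ h s 0 := hy (by simpa using hC0)
      have h1 : h s 0 = s := by simp [h, hW.map_zero, hg0, hs.le]
      have h2 : W x ≤ h s x := le_add_of_nonneg_right (le_max_left _ _)
      linarith
  have hanpos : ∀ s, 0 ≤ a s := fun s => le_ciInf (hnn s)
  have htop : Tendsto a atTop atTop := by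
    refine tendsto_atTop.2 fun R => ?_
    obtain ⟨C, hC⟩ := hW.bounded_sublevel R
    obtain ⟨G, hG⟩ := (isCompact_closedBall (0 : E) C).bddAbove_image hg.continuousOn
    filter_upwards [eventually_ge_atTop (G + R)] with s hs
    refine le_ciInf fun x => ?_
    rcases le_or_gt (W x) R with hx | hx
    · have h1 : g x ≤ G := hG ⟨x, by simpa using hC x hx, rfl⟩
      have h2 : s - g x ≤ max 0 (s - g x) := le_max_right _ _
      have h3 := hW.nonneg x
      simp only [h]
      linarith
    · exact hx.le.trans (le_add_of_nonneg_right (le_max_left _ _))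
  have hfrac : ∀ s : ℝ, 0 ≤ s → s / (1 + s) ≤ 1 := fun s hs => by
    rw [div_le_one (by linarith)]; linarith
  have hfm : ∀ s t : ℝ, 0 ≤ s → s < t → s / (1 + s) < t / (1 + t) := fun s t hs hst => by
    rw [div_lt_div_iff₀ (by linarith) (by linarith)]; linarith
  have hmul : ∀ s, 0 ≤ s → a s * (s / (1 + s)) ≤ a s := fun s hs =>
    mul_le_of_le_one_right (hanpos s) (hfrac s hs)
  refine ⟨fun s => a s * (s / (1 + s)), ⟨⟨?_, ?_, by simp⟩, ?_⟩,
    fun s hs => (hmul s hs).trans (ha0 s hs), fun x hx => (hmul _ hx).trans ?_⟩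
  · refine hcont.continuousOn.mul (continuousOn_id.div (by fun_prop) fun s hs => ?_)
    have : (0 : ℝ) ≤ s := hs
    positivity
  · intro s hs t ht hst
    have hs' : (0 : ℝ) ≤ s := hs
    have h1 := hfm s t hs hst
    have h2 := hmono hst.le
    have h3 := hpos t (hs'.trans_lt hst)
    have h4 : 0 ≤ s / (1 + s) := by positivity
    calc a s * (s / (1 + s)) ≤ a t * (s / (1 + s)) := by gcongr
      _ < a t * (t / (1 + t)) := by gcongr
  · refine tendsto_atTop_mono' _ ?_ (htop.const_mul_atTop (r := 1 / 2) (by norm_num))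
    filter_upwards [eventually_ge_atTop 1] with s hs
    have : 1 / 2 ≤ s / (1 + s) := by
      rw [div_le_div_iff₀ (by norm_num) (by linarith)]; linarith
    rw [mul_comm]
    exact mul_le_mul_of_nonneg_left this (hanpos s)
  · simpa [h] using hle (g x) x

/-- The majorant is `r + sup_{‖y‖ ≤ 1} max 0 (g (r y))`, which is continuous by compactness of the
ball. -/
theorem exists_classK_ge [NormedSpace ℝ E] [ProperSpace E] {g : E → ℝ} (hg : Continuous g)
    (hg0 : g 0 = 0) : ∃ ψ, IsClassK ψ ∧ ∀ x, g x ≤ ψ ‖x‖ := by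
  let K := Metric.closedBall (0 : E) 1
  have hK : IsCompact K := isCompact_closedBall 0 1
  let k : ℝ → E → ℝ := fun r y => max 0 (g (r • y))
  let p : ℝ → ℝ := fun r => sSup (k r '' K)
  have hk : Continuous (Function.uncurry k) := by
    simp only [k, Function.uncurry_def]; fun_prop
  have hb : ∀ r, BddAbove (k r '' K) := fun r =>
    hK.bddAbove_image (Continuous.continuousOn (by simp only [k]; fun_prop))
  have h0K : (0 : E) ∈ K := by simp [K]
  have hkey : ∀ r s y, 0 ≤ r → r ≤ s → 0 < s → y ∈ K → k r y ≤ p s := by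
    intro r s y hr hrs hs hy
    refine le_csSup (hb s) ⟨(r / s) • y, ?_, ?_⟩
    · have : ‖y‖ ≤ 1 := by simpa [K] using hy
      simp only [K, Metric.mem_closedBall, dist_zero_right, norm_smul, Real.norm_eq_abs,
        abs_of_nonneg (div_nonneg hr hs.le)]
      exact mul_le_one₀ ((div_le_one hs).2 hrs) (norm_nonneg _) this
    · simp only [k, smul_smul]
      rw [mul_div_cancel₀ _ hs.ne']
  have hpm : ∀ r s, 0 ≤ r → r < s → p r ≤ p s := fun r s hr hrs =>
    csSup_le ⟨_, 0, h0K, rfl⟩ (by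
      rintro _ ⟨y, hy, rfl⟩; exact hkey r s y hr hrs.le (hr.trans_lt hrs) hy)
  refine ⟨fun r => r + p r, ⟨?_, ?_, ?_⟩, fun x => ?_⟩
  · exact (continuous_id.add (hK.continuous_sSup hk)).continuousOn
  · intro r hr s _ hrs
    exact add_lt_add_of_lt_of_le hrs (hpm r s hr hrs)
  · have : k 0 '' K = {0} := by
      rw [show k 0 = fun _ => 0 by funext y; simp [k, hg0]]
      exact Nonempty.image_const ⟨0, h0K⟩ 0
    simp [p, this]
  · rcases eq_or_ne x 0 with rfl | hx
    · have : 0 ≤ p 0 := (le_max_left _ _).trans (le_csSup (hb 0) ⟨0, h0K, rfl⟩)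
      simpa [hg0] using this
    · have hn : 0 < ‖x‖ := norm_pos_iff.2 hx
      have h1 : k ‖x‖ (‖x‖⁻¹ • x) ≤ p ‖x‖ :=
        le_csSup (hb _) ⟨_, by simp [K, norm_smul, hn.ne'], rfl⟩
      have h2 : g x ≤ k ‖x‖ (‖x‖⁻¹ • x) := by
        simp [k, smul_smul, hn.ne']
      exact (h2.trans h1).trans (le_add_of_nonneg_left hn.le)
end

/-! ### Dissipation and input-to-state stability -/

/-- The solution of `κ' = 2 κ / α` with `κ 1 = 1`, which turns the decay `v' ≤ -α v / 2` into the
exponential decay of `κ v`. Because `α s ≤ s`, it is of class `𝒦∞`. -/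
theorem IsClassK.exists_exponential_rescaling {α : ℝ → ℝ} (hα : IsClassK α)
    (hle : ∀ s, 0 ≤ s → α s ≤ s) :
    ∃ κ, IsClassKInfty κ ∧ ∀ v, 0 < v → HasDerivAt κ (κ v * (2 / α v)) v := by
  let η : ℝ → ℝ := fun v => ∫ s in (1 : ℝ)..v, 2 / α s
  have hc : ContinuousOn (fun s => 2 / α s) (Ioi 0) :=
    continuousOn_const.div (hα.continuousOn.mono Ioi_subset_Ici_self) fun s hs => (hα.pos hs).ne'
  have hη : ∀ v, 0 < v → HasDerivAt η (2 / α v) v := fun v hv => by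
    refine intervalIntegral.integral_hasDerivAt_right ?_
      (hc.stronglyMeasurableAtFilter isOpen_Ioi v hv) (hc.continuousAt (Ioi_mem_nhds hv))
    refine (hc.mono fun s hs => ?_).intervalIntegrable
    exact (lt_min one_pos hv).trans_le hs.1
  have hη1 : η 1 = 0 := intervalIntegral.integral_same
  have hdiff : MonotoneOn (fun v => η v - Real.log v) (Ioi 0) := by
    have hd : ∀ v, 0 < v → HasDerivAt (fun v => η v - Real.log v) (2 / α v - v⁻¹) v :=
      fun v hv => (hη v hv).sub (Real.hasDerivAt_log hv.ne')
    refine monotoneOn_of_deriv_nonneg (convex_Ioi 0)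
      (fun v hv => (hd v hv).continuousAt.continuousWithinAt)
      (fun v hv => ?_) (fun v hv => ?_) <;> rw [interior_Ioi] at hv
    · exact (hd v hv).differentiableAt.differentiableWithinAt
    · rw [(hd v hv).deriv, sub_nonneg, inv_eq_one_div]
      exact div_le_div₀ (by norm_num) (by norm_num) (hα.pos hv) (hle v hv.le)
  have hηm : StrictMonoOn η (Ioi 0) := by
    refine strictMonoOn_of_deriv_pos (convex_Ioi 0)
      (fun v hv => (hη v hv).continuousAt.continuousWithinAt) fun v hv => ?_
    rw [interior_Ioi] at hv
    rw [(hη v hv).deriv]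
    exact div_pos two_pos (hα.pos hv)
  let κ : ℝ → ℝ := fun v => if 0 < v then Real.exp (η v) else 0
  have hκp : ∀ v, 0 < v → κ v = Real.exp (η v) := fun v hv => if_pos hv
  have hκ0 : κ 0 = 0 := if_neg (lt_irrefl 0)
  have hκd : ∀ v, 0 < v → HasDerivAt κ (κ v * (2 / α v)) v := fun v hv => by
    rw [hκp v hv]
    refine (hη v hv).exp.congr_of_eventuallyEq ?_
    filter_upwards [Ioi_mem_nhds hv] with s hs using hκp s hs
  have hge : ∀ v, 1 ≤ v → v ≤ κ v := fun v hv => by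
    have hv0 : 0 < v := one_pos.trans_le hv
    have := hdiff (mem_Ioi.2 one_pos) (mem_Ioi.2 hv0) hv
    rw [hκp v hv0, ← Real.log_le_iff_le_exp hv0]
    simpa [hη1] using this
  have hle1 : ∀ v, 0 ≤ v → v ≤ 1 → κ v ≤ v := fun v hv hv1 => by
    rcases hv.eq_or_lt with rfl | hv0
    · exact hκ0.le
    have := hdiff (mem_Ioi.2 hv0) (mem_Ioi.2 one_pos) hv1
    rw [hκp v hv0, ← Real.le_log_iff_exp_le hv0]
    simpa [hη1] using this
  have hκnn : ∀ v, 0 ≤ κ v := fun v => by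
    simp only [κ]; split_ifs <;> positivity
  refine ⟨κ, ⟨⟨fun v hv => ?_, fun v hv w hw hvw => ?_, hκ0⟩, ?_⟩, hκd⟩
  · rcases (mem_Ici.1 hv).eq_or_lt with rfl | hv0
    · rw [ContinuousWithinAt, hκ0]
      refine tendsto_of_tendsto_of_tendsto_of_le_of_le' tendsto_const_nhds
        (tendsto_id.mono_left nhdsWithin_le_nhds) (.of_forall hκnn) ?_
      filter_upwards [self_mem_nhdsWithin, nhdsWithin_le_nhds (Iio_mem_nhds one_pos)] with s hs hs1
        using hle1 s hs (le_of_lt hs1)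
    · exact (hκd v hv0).continuousAt.continuousWithinAt
  · have hw0 : 0 < w := (mem_Ici.1 hv).trans_lt hvw
    rcases (mem_Ici.1 hv).eq_or_lt with rfl | hv0
    · rw [hκ0, hκp w hw0]; positivity
    · rw [hκp v hv0, hκp w hw0, Real.exp_lt_exp]
      exact hηm hv0 hw0 hvw
  · exact tendsto_atTop_mono' _ ((eventually_ge_atTop 1).mono hge) tendsto_id

/-- A differentiable function on `[0, ∞)` that decreases strictly whenever it exceeds `c` exceeds `c`
at time `t` only if it did so all the time before. -/
theorem lt_of_lt_of_deriv_neg {v v' : ℝ → ℝ} {c t : ℝ}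
    (hv : ∀ s, 0 ≤ s → HasDerivWithinAt v (v' s) (Ici 0) s)
    (hneg : ∀ s, 0 ≤ s → c < v s → v' s < 0) (ht : c < v t) {s : ℝ} (hs : 0 ≤ s) (hst : s ≤ t) :
    c < v s := by
  by_contra! hcon
  have hcont : ContinuousOn v (Icc s t) := fun τ hτ =>
    (hv τ (hs.trans hτ.1)).continuousWithinAt.mono fun _ h => hs.trans h.1
  -- the last time in `[s, t]` at which the function is at most `c`
  obtain ⟨r, ⟨⟨hr, hrc⟩, hmax⟩⟩ :=
    (isCompact_Icc.of_isClosed_subset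
      (hcont.preimage_isClosed_of_isClosed isClosed_Icc (isClosed_Iic (a := c)))
      inter_subset_left).exists_isGreatest ⟨s, ⟨le_rfl, hst⟩, hcon⟩
  have hlt : r < t := hr.2.lt_of_ne fun h => not_lt_of_ge hrc (h ▸ ht)
  have hanti : AntitoneOn v (Icc r t) := by
    refine antitoneOn_of_deriv_nonpos (convex_Icc r t) (hcont.mono (Icc_subset_Icc_left hr.1)) ?_ ?_
    all_goals
      intro τ hτ
      rw [interior_Icc] at hτ
      have hτ0 : 0 < τ := (hs.trans hr.1).trans_lt hτ.1
      have hd := (hv τ hτ0.le).hasDerivAt (Ici_mem_nhds hτ0)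
    · exact hd.differentiableAt.differentiableWithinAt
    · rw [hd.deriv]
      refine (hneg τ hτ0.le ?_).le
      by_contra! h
      exact not_lt_of_ge (hmax ⟨⟨hr.1.trans hτ.1.le, hτ.2.le⟩, h⟩) hτ.1
  have := hanti ⟨le_rfl, hlt.le⟩ ⟨hlt.le, le_rfl⟩ hlt.le
  exact not_lt_of_ge (this.trans hrc) ht

/-- If `v' ≤ -α v + d` and `2 d ≤ α c`, then at each time at which `v` still exceeds `c`, the rescaled
function `κ v` has decayed exponentially since time `0`. -/
theorem rescaled_decay {α κ v v' : ℝ → ℝ} {c d : ℝ} (hα : IsClassK α) (hκ : IsClassK κ)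
    (hκd : ∀ v, 0 < v → HasDerivAt κ (κ v * (2 / α v)) v)
    (hv : ∀ s, 0 ≤ s → HasDerivWithinAt v (v' s) (Ici 0) s)
    (hdec : ∀ s, 0 ≤ s → v' s ≤ -α (v s) + d) (hc : 0 ≤ c) (hcd : 2 * d ≤ α c)
    {t : ℝ} (ht : 0 ≤ t) (hct : c < v t) : κ (v t) ≤ Real.exp (-t) * κ (v 0) := by
  have hhalf : ∀ s, 0 ≤ s → c < v s → v' s ≤ -(α (v s) / 2) := fun s hs hcs => by
    have := hα.mono hc hcs.le
    linarith [hdec s hs]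
  have hgt : ∀ s, 0 ≤ s → s ≤ t → c < v s := fun s hs hst =>
    lt_of_lt_of_deriv_neg hv (fun s hs hcs => by
      have := hα.pos (hc.trans_lt hcs)
      linarith [hhalf s hs hcs]) hct hs hst
  have hd : ∀ s ∈ Icc 0 t, HasDerivWithinAt (fun s => Real.exp s * κ (v s))
      (Real.exp s * κ (v s) + Real.exp s * (κ (v s) * (2 / α (v s)) * v' s)) (Ici 0) s :=
    fun s hs => (Real.hasDerivAt_exp s).hasDerivWithinAt.mul
      ((hκd _ (hc.trans_lt (hgt s hs.1 hs.2))).comp_hasDerivWithinAt s (hv s hs.1))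
  have hanti : AntitoneOn (fun s => Real.exp s * κ (v s)) (Icc 0 t) := by
    refine antitoneOn_of_deriv_nonpos (convex_Icc 0 t)
      (fun s hs => (hd s hs).continuousWithinAt.mono Icc_subset_Ici_self) ?_ ?_
    all_goals
      intro s hs
      rw [interior_Icc] at hs
      have hds := (hd s ⟨hs.1.le, hs.2.le⟩).hasDerivAt (Ici_mem_nhds hs.1)
    · exact hds.differentiableAt.differentiableWithinAt
    · have hcs := hgt s hs.1.le hs.2.le
      have hpos := hα.pos (hc.trans_lt hcs)
      have h1 : 2 / α (v s) * v' s ≤ -1 := by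
        rw [div_mul_eq_mul_div, div_le_iff₀ hpos]
        linarith [hhalf s hs.1.le hcs]
      have h2 : 0 ≤ Real.exp s * κ (v s) :=
        mul_nonneg (Real.exp_pos s).le (hκ.nonneg (hc.trans hcs.le))
      rw [hds.deriv]
      nlinarith
  have := hanti ⟨le_rfl, ht⟩ ⟨ht, le_rfl⟩ ht
  simp only [Real.exp_zero, one_mul] at this
  rw [Real.exp_neg, inv_mul_eq_div, le_div_iff₀ (Real.exp_pos t), mul_comm]
  exact this

/-- The Lyapunov criterion for input-to-state stability, in dissipation form: the estimate holds with
the same `β` and `γ` along all curves on which `V` dissipates at the rate `W` up to the supply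
`q`. -/
theorem exists_iss_estimate_of_dissipation {E F : Type*} [NormedAddCommGroup E] [NormedSpace ℝ E]
    [ProperSpace E] [NormedAddCommGroup F] [NormedSpace ℝ F] [ProperSpace F] {V W : E → ℝ}
    (hV : IsProperPosDef V) (hW : IsProperPosDef W) {q : F → ℝ} (hq : Continuous q)
    (hq0 : q 0 = 0) :
    ∃ (β : ℝ → ℝ → ℝ) (γ : ℝ → ℝ), IsClassKL β ∧ IsClassK γ ∧
      ∀ (x : ℝ → E) (u : ℝ → F) (v' : ℝ → ℝ) (D : ℝ),
        (∀ t, 0 ≤ t → HasDerivWithinAt (fun s => V (x s)) (v' t) (Ici 0) t) →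
        (∀ t, 0 ≤ t → v' t ≤ -W (x t) + q (u t)) → (∀ t, 0 ≤ t → ‖u t‖ ≤ D) →
        ∀ t, 0 ≤ t → ‖x t‖ ≤ β ‖x 0‖ t + γ D := by
  obtain ⟨α, hα, hαle, hαW⟩ := hW.exists_classKInfty_comp_le hV.continuous hV.map_zero
  obtain ⟨α₁, hα₁, -, hα₁V⟩ := hV.exists_classKInfty_comp_le continuous_norm norm_zero
  obtain ⟨κ, hκ, hκd⟩ := hα.toIsClassK.exists_exponential_rescaling hαle
  obtain ⟨ψ, hψ, hψV⟩ := exists_classK_ge hV.continuous hV.map_zero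
  obtain ⟨σ, hσ, hσq⟩ := exists_classK_ge hq hq0
  obtain ⟨αi, hαi, hαr, -⟩ := hα.exists_inverse
  obtain ⟨α₁i, hα₁i, -, hα₁l⟩ := hα₁.exists_inverse
  obtain ⟨κi, hκi, -, hκl⟩ := hκ.exists_inverse
  have hωK := hα₁i.comp hκi
  have hχK := hκ.toIsClassK.comp hψ
  have hβK : ∀ t, IsClassK fun r => α₁i (κi (Real.exp (-t) * κ (ψ r))) := fun t =>
    hωK.comp (hχK.const_mul (Real.exp_pos (-t)))
  have hγK : IsClassK fun r => α₁i (αi (2 * σ r)) := hα₁i.comp (hαi.comp (hσ.const_mul two_pos))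
  refine ⟨fun r t => α₁i (κi (Real.exp (-t) * κ (ψ r))), fun r => α₁i (αi (2 * σ r)),
    ⟨fun t _ => hβK t, fun r hr s _ t _ hst => ?_, fun r hr => ?_⟩, hγK, ?_⟩
  · have := hχK.nonneg hr
    exact hωK.mono (by positivity) (by gcongr)
  · have h1 : Tendsto (fun t => Real.exp (-t) * κ (ψ r)) atTop (𝓝[≥] 0) := by
      refine tendsto_nhdsWithin_iff.2 ⟨?_, .of_forall fun t => ?_⟩
      · simpa using (Real.tendsto_exp_neg_atTop_nhds_zero).mul_const (κ (ψ r))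
      · exact mul_nonneg (Real.exp_pos _).le (hχK.nonneg hr)
    have h2 := hωK.continuousOn 0 self_mem_Ici
    rw [ContinuousWithinAt, hωK.map_zero] at h2
    exact h2.comp h1
  · intro x u v' D hv hdec hu t ht
    have hD : 0 ≤ D := (norm_nonneg _).trans (hu 0 le_rfl)
    have hσD := hσ.nonneg hD
    have hc : 0 ≤ αi (2 * σ D) := hαi.nonneg (by positivity)
    have hx : ∀ y s, 0 ≤ s → V y ≤ s → ‖y‖ ≤ α₁i s := fun y s _ hys => by
      rw [← hα₁l ‖y‖ (norm_nonneg _)]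
      exact hα₁i.mono (hα₁.nonneg (norm_nonneg _)) ((hα₁V y (norm_nonneg _)).trans hys)
    have hβnn := (hβK t).nonneg (norm_nonneg (x 0))
    have hγnn := hγK.nonneg hD
    rcases le_or_gt (V (x t)) (αi (2 * σ D)) with hle | hgt
    · exact (hx _ _ hc hle).trans (le_add_of_nonneg_left hβnn)
    · have hkey := rescaled_decay (d := σ D) hα.toIsClassK hκ.toIsClassK hκd hv (fun s hs => by
        have h1 := hαW (x s) (hV.nonneg _)
        have h2 := (hσq (u s)).trans (hσ.mono (norm_nonneg _) (hu s hs))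
        linarith [hdec s hs]) hc (hαr _ (by positivity)).ge ht hgt
      have h0 : κ (V (x t)) ≤ Real.exp (-t) * κ (ψ ‖x 0‖) := hkey.trans <| by
        gcongr
        exact hκ.mono (hV.nonneg _) (hψV _)
      have h1 : V (x t) ≤ κi (Real.exp (-t) * κ (ψ ‖x 0‖)) := by
        rw [← hκl (V (x t)) (hV.nonneg _)]
        exact hκi.mono (hκ.nonneg (hV.nonneg _)) h0
      exact (hx _ _ ((hV.nonneg _).trans h1) h1).trans (le_add_of_nonneg_right hγnn)

/-! ### Sector nonlinearities -/

variable {n m M : ℕ}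

theorem IsSectorFamily.pos {f : Fin M → Fin n → ℝ → ℝ} (hf : IsSectorFamily f) (j : Fin M)
    (i : Fin n) {ν : ℝ} (hν : 0 < ν) : 0 < f j i ν :=
  (mul_pos_iff_of_pos_left hν).1 (hf.sector j i ν hν.ne')

theorem IsSectorFamily.neg {f : Fin M → Fin n → ℝ → ℝ} (hf : IsSectorFamily f) (j : Fin M)
    (i : Fin n) {ν : ℝ} (hν : ν < 0) : f j i ν < 0 := by
  by_contra! h
  exact not_lt_of_ge (mul_nonpos_of_nonpos_of_nonneg hν.le h) (hf.sector j i ν hν.ne)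

theorem IsSectorFamily.map_zero {f : Fin M → Fin n → ℝ → ℝ} (hf : IsSectorFamily f) (j : Fin M)
    (i : Fin n) : f j i 0 = 0 := by
  have hc := (hf.continuous j i).tendsto 0
  refine le_antisymm (le_of_tendsto (hc.mono_left (nhdsWithin_le_nhds (s := Iio 0))) ?_)
    (ge_of_tendsto (hc.mono_left (nhdsWithin_le_nhds (s := Ioi 0))) ?_)
  · filter_upwards [self_mem_nhdsWithin] with ν hν using (hf.neg j i hν).le
  · filter_upwards [self_mem_nhdsWithin] with ν hν using (hf.pos j i hν).le

theorem IsSectorFamily.mul_pos {f : Fin M → Fin n → ℝ → ℝ} (hf : IsSectorFamily f) (j k : Fin M)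
    (i : Fin n) {ν : ℝ} (hν : ν ≠ 0) : 0 < f j i ν * f k i ν := by
  rcases hν.lt_or_gt with h | h
  · exact mul_pos_of_neg_of_neg (hf.neg j i h) (hf.neg k i h)
  · exact _root_.mul_pos (hf.pos j i h) (hf.pos k i h)

theorem IsSectorFamily.mul_nonneg {f : Fin M → Fin n → ℝ → ℝ} (hf : IsSectorFamily f)
    (j k : Fin M) (i : Fin n) (ν : ℝ) : 0 ≤ f j i ν * f k i ν := by
  rcases eq_or_ne ν 0 with rfl | hν
  · simp [hf.map_zero]
  · exact (hf.mul_pos j k i hν).le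

theorem IsSectorFamily.integral_pos {f : Fin M → Fin n → ℝ → ℝ} (hf : IsSectorFamily f)
    (j : Fin M) (i : Fin n) {ν : ℝ} (hν : ν ≠ 0) : 0 < ∫ τ in (0 : ℝ)..ν, f j i τ := by
  rcases hν.lt_or_gt with h | h
  · rw [intervalIntegral.integral_symm, ← intervalIntegral.integral_neg]
    exact intervalIntegral.intervalIntegral_pos_of_pos_on
      ((hf.continuous j i).neg.intervalIntegrable _ _)
      (fun τ hτ => neg_pos.2 (hf.neg j i hτ.2)) h
  · exact intervalIntegral.intervalIntegral_pos_of_pos_on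
      ((hf.continuous j i).intervalIntegrable _ _) (fun τ hτ => hf.pos j i hτ.1) h

theorem IsSectorFamily.integral_nonneg {f : Fin M → Fin n → ℝ → ℝ} (hf : IsSectorFamily f)
    (j : Fin M) (i : Fin n) (ν : ℝ) : 0 ≤ ∫ τ in (0 : ℝ)..ν, f j i τ := by
  rcases eq_or_ne ν 0 with rfl | hν
  · simp
  · exact (hf.integral_pos j i hν).le

/-- The nonlinearities indexed by `{0, …, M}`, where the one with index `0` is the identity: the
multipliers `Υ s z` pair these. -/
def consId (f : Fin M → Fin n → ℝ → ℝ) : Fin (M + 1) → Fin n → ℝ → ℝ :=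
  Fin.cons (fun _ ν => ν) f

theorem IsSectorFamily.consId {f : Fin M → Fin n → ℝ → ℝ} (hf : IsSectorFamily f) :
    IsSectorFamily (consId f) where
  continuous j i := by
    refine Fin.cases ?_ (fun j => ?_) j
    exacts [continuous_id, hf.continuous j i]
  sector j i ν hν := by
    refine Fin.cases ?_ (fun j => ?_) j
    exacts [mul_self_pos.2 hν, hf.sector j i ν hν]

theorem IsGrowthIndices.consId_tendsto_atTop {f : Fin M → Fin n → ℝ → ℝ} {φ μ : ℕ}
    (h : IsGrowthIndices f φ μ) {s : Fin (M + 1)} (hs : s.val ≤ φ) (i : Fin n) :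
    Tendsto (consId f s i) atTop atTop := by
  revert hs
  refine Fin.cases (fun _ => tendsto_id) (fun j hj => ?_) s
  exact h.tendsto_atTop j (by simpa [Nat.succ_le_iff] using hj) i

theorem IsGrowthIndices.consId_tendsto_atBot {f : Fin M → Fin n → ℝ → ℝ} {φ μ : ℕ}
    (h : IsGrowthIndices f φ μ) {s : Fin (M + 1)} (hs : s.val ≤ φ) (i : Fin n) :
    Tendsto (consId f s i) atBot atBot := by
  revert hs
  refine Fin.cases (fun _ => tendsto_id) (fun j hj => ?_) s
  exact h.tendsto_atBot j (by simpa [Nat.succ_le_iff] using hj) i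

theorem exists_abs_le_of_tendsto_atTop {h : ℝ → ℝ} (htop : Tendsto h atTop atTop)
    (hbot : Tendsto h atBot atTop) (R : ℝ) : ∃ C, ∀ ν, h ν ≤ R → |ν| ≤ C := by
  obtain ⟨a, ha⟩ := eventually_atTop.1 (htop.eventually_gt_atTop R)
  obtain ⟨b, hb⟩ := eventually_atBot.1 (hbot.eventually_gt_atTop R)
  refine ⟨max a (-b), fun ν hν => abs_le'.2 ⟨?_, ?_⟩⟩
  · by_contra! hlt
    exact not_lt_of_ge hν (ha ν ((le_max_left _ _).trans hlt.le))
  · by_contra! hlt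
    exact not_lt_of_ge hν (hb ν (by linarith [le_max_right a (-b)]))

/-! ### The Lyapunov function and its dissipation rate -/

theorem isProperPosDef_sum_coord {w : Fin n → ℝ → ℝ} (hw : ∀ i, IsProperPosDef (w i)) :
    IsProperPosDef fun x : EuclideanSpace ℝ (Fin n) => ∑ i, w i (x i) where
  continuous := by
    have := fun i => (hw i).continuous
    fun_prop
  map_zero := by simp [(hw _).map_zero]
  pos x hx := by
    obtain ⟨i, hi⟩ : ∃ i, x i ≠ 0 := by
      by_contra! h
      exact hx (by ext i; simpa using h i)
    exact Finset.sum_pos' (fun i _ => (hw i).nonneg _) ⟨i, Finset.mem_univ i, (hw i).pos _ hi⟩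
  bounded_sublevel R := by
    choose C hC using fun i => (hw i).bounded_sublevel R
    refine ⟨√(∑ i, C i ^ 2), fun x hx => ?_⟩
    rw [EuclideanSpace.norm_eq]
    refine Real.sqrt_le_sqrt (Finset.sum_le_sum fun i _ => ?_)
    have h1 : w i (x i) ≤ R := (Finset.single_le_sum (f := fun i => w i (x i))
      (fun i _ => (hw i).nonneg _) (Finset.mem_univ i)).trans hx
    exact pow_le_pow_left₀ (norm_nonneg _) (hC i _ h1) 2

open Matrix in
theorem Matrix.PosDef.exists_mul_sq_norm_le {A : Matrix (Fin n) (Fin n) ℝ} (hA : A.PosDef) :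
    ∃ c, 0 < c ∧ ∀ x : EuclideanSpace ℝ (Fin n), c * ‖x‖ ^ 2 ≤ x.ofLp ⬝ᵥ A *ᵥ x.ofLp := by
  let S := Metric.sphere (0 : EuclideanSpace ℝ (Fin n)) 1
  have hcont : Continuous fun x : EuclideanSpace ℝ (Fin n) => x.ofLp ⬝ᵥ A *ᵥ x.ofLp := by
    fun_prop
  have hpos : ∀ x : EuclideanSpace ℝ (Fin n), x ≠ 0 → 0 < x.ofLp ⬝ᵥ A *ᵥ x.ofLp := fun x hx => by
    simpa using hA.dotProduct_mulVec_pos (x := x.ofLp) (by simpa using hx)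
  have hscale : ∀ x : EuclideanSpace ℝ (Fin n), x ≠ 0 → ‖x‖⁻¹ • x ∈ S := fun x hx => by
    simp [S, norm_smul, hx]
  -- the sphere is empty exactly if `n = 0`
  rcases S.eq_empty_or_nonempty with hS | hS
  · refine ⟨1, one_pos, fun x => ?_⟩
    have : x = 0 := by
      by_contra hx
      simpa [hS] using hscale x hx
    simp [this]
  · obtain ⟨y, hyS, hy⟩ := (isCompact_sphere 0 1).exists_isMinOn hS hcont.continuousOn
    refine ⟨_, hpos y (ne_zero_of_mem_unit_sphere ⟨y, hyS⟩), fun x => ?_⟩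
    rcases eq_or_ne x 0 with rfl | hx
    · simp
    · have h1 := hy (hscale x hx)
      have hn : 0 < ‖x‖ := norm_pos_iff.2 hx
      simp only [mem_ofPred_eq, WithLp.ofLp_smul, mulVec_smul, dotProduct_smul, smul_dotProduct,
        smul_eq_mul] at h1
      calc _ ≤ (‖x‖⁻¹ * (‖x‖⁻¹ * (x.ofLp ⬝ᵥ A *ᵥ x.ofLp))) * ‖x‖ ^ 2 := by gcongr
        _ = _ := by field_simp

/-- The Lyapunov function `xᵀ P x + 2 ∑ⱼ ∑ᵢ Λʲᵢ ∫₀^{xᵢ} fⱼⁱ` of Lur'e-Postnikov type. -/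
noncomputable def lureFunction (P : Matrix (Fin n) (Fin n) ℝ) (Λ : Fin M → Fin n → ℝ)
    (f : Fin M → Fin n → ℝ → ℝ) (x : EuclideanSpace ℝ (Fin n)) : ℝ :=
  x.ofLp ⬝ᵥ P.mulVec x.ofLp + 2 * ∑ j, ∑ i, Λ j i * ∫ τ in (0 : ℝ)..x i, f j i τ

/-- The `i`-th coordinate's part of the dissipation rate: `∑ⱼ Ξʲᵢ fⱼⁱ(ν)²` plus twice the products
of pairs of nonlinearities (the identity included) with the weights `Υ s z`. -/
def dissipationCoord (Ξ : Fin M → Fin n → ℝ) (Υ : Fin (M + 1) → Fin (M + 1) → Fin n → ℝ)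
    (f : Fin M → Fin n → ℝ → ℝ) (i : Fin n) (ν : ℝ) : ℝ :=
  ∑ j, Ξ j i * (f j i ν * f j i ν) +
    2 * ∑ s, ∑ z, if s < z then Υ s z i * (consId f s i ν * consId f z i ν) else 0

/-- The LMI on `Ξ` and `Υ` says that in each coordinate at least one product of two radially unbounded
nonlinearities carries a positive weight. -/
theorem IsLMISolution.exists_le_dissipationCoord {Γ : Fin M → Matrix (Fin n) (Fin n) ℝ} {φ μ : ℕ}
    {P : Matrix (Fin n) (Fin n) ℝ} {Λ Ξ : Fin M → Fin n → ℝ}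
    {Υ : Fin (M + 1) → Fin (M + 1) → Fin n → ℝ} {Φ : Matrix (Fin n) (Fin n) ℝ} {ρ : ℝ}
    (h : IsLMISolution Γ φ μ P Λ Ξ Υ Φ ρ) {f : Fin M → Fin n → ℝ → ℝ} (hf : IsSectorFamily f)
    (i : Fin n) :
    ∃ c > 0, ∃ s z : Fin (M + 1), s.val ≤ φ ∧ z.val ≤ φ ∧
      ∀ ν, c * (consId f s i ν * consId f z i ν) ≤ dissipationCoord Ξ Υ f i ν := by
  have hd := h.lmi_sum.diag_pos (i := i)
  simp only [Matrix.add_apply, Matrix.smul_apply, Matrix.sum_apply, Matrix.diagonal_apply_eq,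
    smul_eq_mul] at hd
  have h1 : ∀ ν j, 0 ≤ Ξ j i * (f j i ν * f j i ν) := fun ν j =>
    mul_nonneg (h.Ξ_nonneg j i) (hf.mul_nonneg j j i ν)
  have h2 : ∀ ν s z,
      0 ≤ if s < z then Υ s z i * (consId f s i ν * consId f z i ν) else 0 := fun ν s z => by
    split_ifs with hsz
    exacts [mul_nonneg (h.Υ_nonneg s z hsz i) (hf.consId.mul_nonneg s z i ν), le_rfl]
  have h1s := fun ν => Finset.sum_nonneg fun j (_ : j ∈ Finset.univ) => h1 ν j
  have h2s := fun ν s => Finset.sum_nonneg fun z (_ : z ∈ Finset.univ) => h2 ν s z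
  have h2ss := fun ν => Finset.sum_nonneg fun s (_ : s ∈ Finset.univ) => h2s ν s
  by_cases hex : ∃ k : Fin M, k.val < φ ∧ 0 < Ξ k i
  · obtain ⟨k, hk, hpos⟩ := hex
    refine ⟨Ξ k i, hpos, k.succ, k.succ, by simpa [Nat.succ_le_iff] using hk,
      by simpa [Nat.succ_le_iff] using hk, fun ν => ?_⟩
    have := Finset.single_le_sum (fun j _ => h1 ν j) (Finset.mem_univ k)
    have h3 := h2ss ν
    simp only [dissipationCoord]
    simp only [consId, Fin.cons_succ] at *
    linarith
  by_cases hex' : ∃ s z : Fin (M + 1), s.val ≤ φ ∧ s < z ∧ z.val ≤ φ ∧ 0 < Υ s z i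
  · obtain ⟨s, z, hs, hsz, hz, hpos⟩ := hex'
    refine ⟨2 * Υ s z i, by positivity, s, z, hs, hz, fun ν => ?_⟩
    have h3 := Finset.single_le_sum (fun z _ => h2 ν s z) (Finset.mem_univ z)
    have h4 := Finset.single_le_sum (fun s _ => h2s ν s) (Finset.mem_univ s)
    have h5 := h1s ν
    rw [if_pos hsz] at h3
    simp only [dissipationCoord]
    linarith
  push Not at hex hex'
  refine absurd hd (not_lt_of_ge (add_nonpos ?_ (mul_nonpos_of_nonneg_of_nonpos zero_le_two ?_)))
  · exact Finset.sum_nonpos fun k hk => hex k (by simpa using hk)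
  · refine Finset.sum_nonpos fun s hs => Finset.sum_nonpos fun z hz => ?_
    simp only [Finset.mem_filter, Finset.mem_univ, true_and] at hs hz
    exact hex' s z hs hz.1 hz.2

theorem IsLMISolution.isProperPosDef_dissipation {Γ : Fin M → Matrix (Fin n) (Fin n) ℝ} {φ μ : ℕ}
    {P : Matrix (Fin n) (Fin n) ℝ} {Λ Ξ : Fin M → Fin n → ℝ}
    {Υ : Fin (M + 1) → Fin (M + 1) → Fin n → ℝ} {Φ : Matrix (Fin n) (Fin n) ℝ} {ρ : ℝ}
    (h : IsLMISolution Γ φ μ P Λ Ξ Υ Φ ρ) {f : Fin M → Fin n → ℝ → ℝ} (hf : IsSectorFamily f)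
    (hgrowth : IsGrowthIndices f φ μ) :
    IsProperPosDef fun x : EuclideanSpace ℝ (Fin n) => ∑ i, dissipationCoord Ξ Υ f i (x i) := by
  refine isProperPosDef_sum_coord fun i => ?_
  obtain ⟨c, hc, s, z, hs, hz, hle⟩ := h.exists_le_dissipationCoord hf i
  refine ⟨?_, ?_, fun ν hν => ?_, ?_⟩
  · have h1 := hf.continuous
    have h2 := hf.consId.continuous
    unfold dissipationCoord
    refine .add (by fun_prop) (.mul (by fun_prop) (continuous_finsetSum _ fun s _ =>
      continuous_finsetSum _ fun z _ => ?_))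
    split_ifs <;> fun_prop
  · simp [dissipationCoord, hf.map_zero, hf.consId.map_zero]
  · exact (mul_pos hc (hf.consId.mul_pos s z i hν)).trans_le (hle ν)
  · refine exists_abs_le_of_tendsto_atTop (tendsto_atTop_mono hle ?_) (tendsto_atTop_mono hle ?_)
    · exact ((hgrowth.consId_tendsto_atTop hs i).atTop_mul_atTop₀
        (hgrowth.consId_tendsto_atTop hz i)).const_mul_atTop hc
    · exact ((hgrowth.consId_tendsto_atBot hs i).atBot_mul_atBot₀
        (hgrowth.consId_tendsto_atBot hz i)).const_mul_atTop hc

/-- Where `Λ` vanishes in a coordinate, the integrals give no control of it; there `P` takes over,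
because `P + ρ ∑ Λʲ` is positive definite. -/
theorem IsLMISolution.isProperPosDef_lureFunction {Γ : Fin M → Matrix (Fin n) (Fin n) ℝ} {φ μ : ℕ}
    {P : Matrix (Fin n) (Fin n) ℝ} {Λ Ξ : Fin M → Fin n → ℝ}
    {Υ : Fin (M + 1) → Fin (M + 1) → Fin n → ℝ} {Φ : Matrix (Fin n) (Fin n) ℝ} {ρ : ℝ}
    (h : IsLMISolution Γ φ μ P Λ Ξ Υ Φ ρ) {f : Fin M → Fin n → ℝ → ℝ} (hf : IsSectorFamily f)
    (hgrowth : IsGrowthIndices f φ μ) : IsProperPosDef (lureFunction P Λ f) := by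
  have hPnn : ∀ x : Fin n → ℝ, 0 ≤ x ⬝ᵥ P.mulVec x := fun x => by
    simpa using h.P_nonneg.dotProduct_mulVec_nonneg x
  have hInn : ∀ (x : EuclideanSpace ℝ (Fin n)) j i, 0 ≤ Λ j i * ∫ τ in (0 : ℝ)..x i, f j i τ :=
    fun x j i => mul_nonneg (h.Λ_nonneg j i) (hf.integral_nonneg j i _)
  have hIle : ∀ (x : EuclideanSpace ℝ (Fin n)) j i,
      2 * (Λ j i * ∫ τ in (0 : ℝ)..x i, f j i τ) + x.ofLp ⬝ᵥ P.mulVec x.ofLp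
        ≤ lureFunction P Λ f x := fun x j i => by
    have h1 := Finset.single_le_sum (fun i _ => hInn x j i) (Finset.mem_univ i)
    have h2 := Finset.single_le_sum (f := fun j => ∑ i, Λ j i * ∫ τ in (0 : ℝ)..x i, f j i τ)
      (fun j _ => Finset.sum_nonneg fun i _ => hInn x j i) (Finset.mem_univ j)
    simp only [lureFunction] at h2 ⊢
    linarith
  have hPle : ∀ x : EuclideanSpace ℝ (Fin n),
      x.ofLp ⬝ᵥ P.mulVec x.ofLp ≤ lureFunction P Λ f x := fun x => by
    refine le_add_of_nonneg_right (mul_nonneg zero_le_two ?_)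
    exact Finset.sum_nonneg fun j _ => Finset.sum_nonneg fun i _ => hInn x j i
  have hsum : ∀ x : EuclideanSpace ℝ (Fin n),
      x.ofLp ⬝ᵥ (P + ρ • ∑ j : Fin M with j.val < μ, Matrix.diagonal (Λ j)).mulVec x.ofLp
        = x.ofLp ⬝ᵥ P.mulVec x.ofLp + ρ * ∑ j : Fin M with j.val < μ, ∑ i, Λ j i * x i ^ 2 := by
    intro x
    rw [Matrix.add_mulVec, dotProduct_add, Matrix.smul_mulVec, dotProduct_smul, smul_eq_mul,
      Matrix.sum_mulVec, dotProduct_sum]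
    congr 2
    refine Finset.sum_congr rfl fun j _ => Finset.sum_congr rfl fun i _ => ?_
    rw [Matrix.mulVec_diagonal]
    ring
  obtain ⟨c, hc, hcle⟩ := h.lmi_pos.exists_mul_sq_norm_le
  refine ⟨?_, by simp [lureFunction], fun x hx => ?_, fun R => ?_⟩
  · have hI : ∀ j i, Continuous fun ν : ℝ => ∫ τ in (0 : ℝ)..ν, f j i τ := fun j i =>
      intervalIntegral.continuous_primitive
        (fun a b => (hf.continuous j i).intervalIntegrable a b) 0
    have hI' : ∀ j i, Continuous fun x : EuclideanSpace ℝ (Fin n) =>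
        ∫ τ in (0 : ℝ)..x i, f j i τ := fun j i => (hI j i).comp (by fun_prop)
    unfold lureFunction
    fun_prop
  · by_contra! hV
    have hP0 : x.ofLp ⬝ᵥ P.mulVec x.ofLp = 0 := le_antisymm ((hPle x).trans hV) (hPnn _)
    have hΛ0 : ∀ j i, Λ j i * x i ^ 2 = 0 := fun j i => by
      rcases eq_or_ne (x i) 0 with hi | hi
      · simp [hi]
      · have h1 := (hIle x j i).trans hV
        have h2 := hInn x j i
        have h3 : Λ j i * ∫ τ in (0 : ℝ)..x i, f j i τ = 0 := by linarith
        rcases mul_eq_zero.1 h3 with h3 | h3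
        · simp [h3]
        · exact absurd h3 (hf.integral_pos j i hi).ne'
    have h4 := hcle x
    rw [hsum, hP0] at h4
    simp only [hΛ0, Finset.sum_const_zero, mul_zero, add_zero] at h4
    have : 0 < c * ‖x‖ ^ 2 := by
      have := norm_pos_iff.2 hx
      positivity
    linarith
  · have hb : ∀ j i, ∃ C, j.val < μ → ∀ x, lureFunction P Λ f x ≤ R → Λ j i * x i ^ 2 ≤ C := by
      intro j i
      by_cases hj : j.val < μ
      · rcases (h.Λ_nonneg j i).eq_or_lt with h0 | h0
        · exact ⟨0, fun _ x _ => by simp [← h0]⟩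
        · obtain ⟨C, hC⟩ := exists_abs_le_of_tendsto_atTop (hgrowth.integral_atTop j hj i)
            (hgrowth.integral_atBot j hj i) (R / (2 * Λ j i))
          refine ⟨Λ j i * C ^ 2, fun _ x hx => ?_⟩
          have h1 : |x i| ≤ C := hC _ <| by
            rw [le_div_iff₀ (by positivity)]
            linarith [hIle x j i, hPnn x.ofLp]
          rw [← sq_abs]
          gcongr
      · exact ⟨0, fun h => absurd h hj⟩
    choose C hC using hb
    let D := R + |ρ| * ∑ j : Fin M with j.val < μ, ∑ i, C j i
    refine ⟨√(D / c), fun x hx => Real.le_sqrt_of_sq_le ?_⟩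
    rw [le_div_iff₀ hc, mul_comm]
    refine (hcle x).trans ?_
    rw [hsum]
    have hnn : 0 ≤ ∑ j : Fin M with j.val < μ, ∑ i, Λ j i * x i ^ 2 :=
      Finset.sum_nonneg fun j _ => Finset.sum_nonneg fun i _ =>
        mul_nonneg (h.Λ_nonneg j i) (sq_nonneg _)
    refine add_le_add ((hPle x).trans hx)
      ((mul_le_mul_of_nonneg_right (le_abs_self ρ) hnn).trans
        (mul_le_mul_of_nonneg_left (Finset.sum_le_sum fun j hj =>
          Finset.sum_le_sum fun i _ => ?_) (abs_nonneg ρ)))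
    exact hC j i (by simpa using hj) x hx

/-! ### The dissipation inequality -/

open Matrix in
theorem dotProduct_mulVec_of_blocks {ι : Type*} [Fintype ι] (Q : ι → ι → Matrix (Fin n) (Fin n) ℝ)
    (z : ι → Fin n → ℝ) :
    (fun a : ι × Fin n => z a.1 a.2) ⬝ᵥ
        (Matrix.of fun a b : ι × Fin n => Q a.1 b.1 a.2 b.2) *ᵥ (fun a => z a.1 a.2)
      = ∑ a, ∑ b, z a ⬝ᵥ Q a b *ᵥ z b := by
  simp only [dotProduct, mulVec, Matrix.of_apply, Fintype.sum_prod_type, Finset.mul_sum]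
  exact Finset.sum_congr rfl fun a _ => Finset.sum_comm

open Matrix in
theorem dotProduct_transpose_mulVec_comm (A : Matrix (Fin n) (Fin n) ℝ) (v w : Fin n → ℝ) :
    v ⬝ᵥ Aᵀ *ᵥ w = w ⬝ᵥ A *ᵥ v := by
  rw [mulVec_transpose, dotProduct_comm, ← dotProduct_mulVec]

open Matrix in
/-- The quadratic form of the inner blocks: the terms in `Λ` and `Γ` that appear in the derivative of
the Lyapunov function, and the multiplier terms. -/
theorem sum_lmiBlock_inner (P : Matrix (Fin n) (Fin n) ℝ) (Γ : Fin M → Matrix (Fin n) (Fin n) ℝ)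
    (Λ Ξ : Fin M → Fin n → ℝ) (Υ : Fin (M + 1) → Fin (M + 1) → Fin n → ℝ)
    (Φ : Matrix (Fin n) (Fin n) ℝ) (F : Fin M → Fin n → ℝ) :
    ∑ s, ∑ z, F s ⬝ᵥ lmiBlock P Γ Λ Ξ Υ Φ (.inr (.inl s)) (.inr (.inl z)) *ᵥ F z
      = 2 * ∑ s, F s ⬝ᵥ diagonal (Λ s) *ᵥ ∑ z, Γ z *ᵥ F z
        + ∑ s, F s ⬝ᵥ diagonal (Ξ s) *ᵥ F s
        + 2 * ∑ s, ∑ z, if s < z then F s ⬝ᵥ diagonal (Υ s.succ z.succ) *ᵥ F z else 0 := by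
  let G : Fin M → Fin M → ℝ := fun s z => F s ⬝ᵥ diagonal (Λ s) *ᵥ (Γ z *ᵥ F z)
  let T : Fin M → Fin M → ℝ := fun s z =>
    if s < z then F s ⬝ᵥ diagonal (Υ s.succ z.succ) *ᵥ F z else 0
  have hG' : ∀ s z, F s ⬝ᵥ ((Γ s)ᵀ * diagonal (Λ z)) *ᵥ F z = G z s := fun s z => by
    rw [← diagonal_transpose, ← transpose_mul, dotProduct_transpose_mulVec_comm, ← mulVec_mulVec]
  have hblock : ∀ s z, F s ⬝ᵥ lmiBlock P Γ Λ Ξ Υ Φ (.inr (.inl s)) (.inr (.inl z)) *ᵥ F z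
      = G s z + G z s + (if s = z then F s ⬝ᵥ diagonal (Ξ s) *ᵥ F s else 0) + T s z + T z s := by
    intro s z
    rcases lt_trichotomy s z with h | rfl | h
    · simp only [lmiBlock, T, h, h.ne, h.not_gt, if_true, if_false, add_mulVec, dotProduct_add, hG']
      simp only [G, mulVec_mulVec]
      ring
    · simp only [lmiBlock, T, lt_irrefl, if_true, if_false, add_mulVec, dotProduct_add, hG']
      simp only [G, mulVec_mulVec]
      ring
    · simp only [lmiBlock, T, h, h.ne', h.not_gt, if_true, if_false,
        dotProduct_transpose_mulVec_comm, add_mulVec, dotProduct_add, hG']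
      simp only [G, mulVec_mulVec]
      ring
  have hGs : ∀ s, F s ⬝ᵥ diagonal (Λ s) *ᵥ ∑ z, Γ z *ᵥ F z = ∑ z, G s z := fun s => by
    rw [mulVec_sum, dotProduct_sum]
  simp only [hblock, hGs, Finset.sum_add_distrib, Finset.sum_ite_eq, Finset.mem_univ, if_true]
  rw [Finset.sum_comm (f := fun s z => G z s), Finset.sum_comm (f := fun s z => T z s)]
  ring

open Matrix in
/-- The inequality `Q ≤ 0` at the vector `(y, F₁, …, F_M, b)`. -/
theorem IsLMISolution.quadratic_le {Γ : Fin M → Matrix (Fin n) (Fin n) ℝ} {φ μ : ℕ}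
    {P : Matrix (Fin n) (Fin n) ℝ} {Λ Ξ : Fin M → Fin n → ℝ}
    {Υ : Fin (M + 1) → Fin (M + 1) → Fin n → ℝ} {Φ : Matrix (Fin n) (Fin n) ℝ} {ρ : ℝ}
    (h : IsLMISolution Γ φ μ P Λ Ξ Υ Φ ρ) (y b : Fin n → ℝ) (F : Fin M → Fin n → ℝ) :
    2 * (y ⬝ᵥ P *ᵥ (∑ j, Γ j *ᵥ F j + b))
        + 2 * ∑ j, F j ⬝ᵥ diagonal (Λ j) *ᵥ (∑ j, Γ j *ᵥ F j + b)
      ≤ -(∑ j, F j ⬝ᵥ diagonal (Ξ j) *ᵥ F j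
          + 2 * (∑ z : Fin M, y ⬝ᵥ diagonal (Υ 0 z.succ) *ᵥ F z
            + ∑ s : Fin M, ∑ z : Fin M,
              if s < z then F s ⬝ᵥ diagonal (Υ s.succ z.succ) *ᵥ F z else 0))
        + b ⬝ᵥ Φ *ᵥ b := by
  have hQ := h.lmi_Q.dotProduct_mulVec_nonneg
    fun a => (Sum.elim (fun _ => y) (Sum.elim F fun _ => b) a.1 : Fin n → ℝ) a.2
  rw [neg_mulVec, dotProduct_neg, star_trivial, lmiMatrix,
    dotProduct_mulVec_of_blocks (lmiBlock P Γ Λ Ξ Υ Φ)] at hQ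
  simp only [Fintype.sum_sum_type, Finset.sum_add_distrib, Sum.elim_inl, Sum.elim_inr,
    sum_lmiBlock_inner, Finset.univ_unique, Finset.sum_singleton] at hQ
  simp only [lmiBlock, dotProduct_transpose_mulVec_comm, zero_mulVec, dotProduct_zero, neg_mulVec,
    dotProduct_neg, add_mulVec, dotProduct_add, Finset.sum_add_distrib, ← mulVec_mulVec] at hQ
  simp only [mulVec_add, dotProduct_add, Finset.sum_add_distrib, mulVec_sum, dotProduct_sum]
    at hQ ⊢
  linarith

open Matrix in
theorem HasDerivWithinAt.lureFunction_comp {P : Matrix (Fin n) (Fin n) ℝ} (hP : P.IsHermitian)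
    (Λ : Fin M → Fin n → ℝ) {f : Fin M → Fin n → ℝ → ℝ} (hf : ∀ j i, Continuous (f j i))
    {x : ℝ → EuclideanSpace ℝ (Fin n)} {x' : EuclideanSpace ℝ (Fin n)} {S : Set ℝ} {t : ℝ}
    (hx : HasDerivWithinAt x x' S t) :
    HasDerivWithinAt (fun s => lureFunction P Λ f (x s))
      (2 * ((x t).ofLp ⬝ᵥ P *ᵥ x'.ofLp)
        + 2 * ∑ j, (fun i => f j i (x t i)) ⬝ᵥ diagonal (Λ j) *ᵥ x'.ofLp) S t := by
  have hxi : ∀ i, HasDerivWithinAt (fun s => x s i) (x' i) S t := fun i =>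
    (EuclideanSpace.proj (𝕜 := ℝ) i).hasFDerivAt.comp_hasDerivWithinAt t hx
  have hquad : HasDerivWithinAt (fun s => (x s).ofLp ⬝ᵥ P *ᵥ (x s).ofLp)
      (x'.ofLp ⬝ᵥ P *ᵥ (x t).ofLp + (x t).ofLp ⬝ᵥ P *ᵥ x'.ofLp) S t := by
    simp only [dotProduct, mulVec, ← Finset.sum_add_distrib]
    exact .fun_sum fun i _ => (hxi i).mul (.fun_sum fun k _ => (hxi k).const_mul _)
  have hint : HasDerivWithinAt (fun s => ∑ j, ∑ i, Λ j i * ∫ τ in (0 : ℝ)..x s i, f j i τ)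
      (∑ j, ∑ i, Λ j i * (f j i (x t i) * x' i)) S t := by
    refine .fun_sum fun j _ => .fun_sum fun i _ => .const_mul _ ?_
    have hF : HasDerivAt (fun ν => ∫ τ in (0 : ℝ)..ν, f j i τ) (f j i (x t i)) (x t i) :=
      ((hf j i).integral_hasStrictDerivAt 0 (x t i)).hasDerivAt
    exact hF.comp_hasDerivWithinAt t (hxi i)
  refine (hquad.add (hint.const_mul 2)).congr_deriv ?_
  rw [← dotProduct_transpose_mulVec_comm, show Pᵀ = P from hP, two_mul (_ ⬝ᵥ _)]
  congr 2
  refine Finset.sum_congr rfl fun j _ => Finset.sum_congr rfl fun i _ => ?_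
  rw [mulVec_diagonal]
  ring

open Matrix in
/-- In the derivative of the Lyapunov function along a solution, `Q ≤ 0` bounds everything but the
multiplier terms and the supply `(B u)ᵀ Φ (B u)`. -/
theorem IsLMISolution.lure_dissipation {Γ : Fin M → Matrix (Fin n) (Fin n) ℝ} {φ μ : ℕ}
    {P : Matrix (Fin n) (Fin n) ℝ} {Λ Ξ : Fin M → Fin n → ℝ}
    {Υ : Fin (M + 1) → Fin (M + 1) → Fin n → ℝ} {Φ : Matrix (Fin n) (Fin n) ℝ} {ρ : ℝ}
    (h : IsLMISolution Γ φ μ P Λ Ξ Υ Φ ρ) (f : Fin M → Fin n → ℝ → ℝ)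
    (B : Matrix (Fin n) (Fin m) ℝ) (x : EuclideanSpace ℝ (Fin n)) (u : EuclideanSpace ℝ (Fin m)) :
    2 * (x.ofLp ⬝ᵥ P *ᵥ (identifiedField Γ f B x u).ofLp)
        + 2 * ∑ j, (fun i => f j i (x i)) ⬝ᵥ diagonal (Λ j) *ᵥ (identifiedField Γ f B x u).ofLp
      ≤ -∑ i, dissipationCoord Ξ Υ f i (x i)
        + (B *ᵥ u.ofLp) ⬝ᵥ Φ *ᵥ (B *ᵥ u.ofLp) := by
  have hkey := h.quadratic_le x.ofLp (B *ᵥ u.ofLp) fun j i => f j i (x i)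
  have hdiag : ∀ d v w : Fin n → ℝ, v ⬝ᵥ diagonal d *ᵥ w = ∑ i, d i * (v i * w i) :=
    fun d v w => Finset.sum_congr rfl fun i _ => by rw [mulVec_diagonal]; ring
  have hW : ∑ i, dissipationCoord Ξ Υ f i (x i)
      = ∑ j, (fun i => f j i (x i)) ⬝ᵥ diagonal (Ξ j) *ᵥ (fun i => f j i (x i))
          + 2 * (∑ z : Fin M, x.ofLp ⬝ᵥ diagonal (Υ 0 z.succ) *ᵥ (fun i => f z i (x i))
            + ∑ s : Fin M, ∑ z : Fin M, if s < z then
              (fun i => f s i (x i)) ⬝ᵥ diagonal (Υ s.succ z.succ) *ᵥ (fun i => f z i (x i))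
              else 0) := by
    simp only [dissipationCoord, hdiag, Finset.sum_add_distrib, ← Finset.mul_sum]
    rw [Finset.sum_comm]
    congr 2
    simp only [Fin.sum_univ_succ, consId, Fin.cons_zero, Fin.cons_succ, if_false,
      Fin.succ_pos, if_true, Fin.not_lt_zero, Fin.succ_lt_succ_iff, zero_add,
      Finset.sum_add_distrib]
    congr 1
    · exact Finset.sum_comm
    · rw [Finset.sum_comm]
      refine Finset.sum_congr rfl fun s _ => ?_
      rw [Finset.sum_comm]
      refine Finset.sum_congr rfl fun z _ => ?_
      split_ifs <;> simp
  rw [hW]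
  exact hkey

theorem norm_le_inputSupNorm {U : Set (EuclideanSpace ℝ (Fin m))}
    {u : ℝ → EuclideanSpace ℝ (Fin m)} (hu : IsAdmissibleInput U u) {t : ℝ} (ht : 0 ≤ t) :
    ‖u t‖ ≤ inputSupNorm u := by
  obtain ⟨C, hC⟩ := hu.bounded
  exact le_ciSup (f := fun t : Ici (0 : ℝ) => ‖u t‖) ⟨C, by rintro _ ⟨s, rfl⟩; exact hC s s.2⟩
    ⟨t, ht⟩

/-! ### Input-to-state stability of the identified model -/

theorem mainTheorem1 {n m M : ℕ} (U : Set (EuclideanSpace ℝ (Fin m)))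
    (Γ : Fin M → Matrix (Fin n) (Fin n) ℝ) (B : Matrix (Fin n) (Fin m) ℝ)
    (f : Fin M → Fin n → ℝ → ℝ) (hf : IsSectorFamily f)
    (φ μ : ℕ) (hgrowth : IsGrowthIndices f φ μ) (hφ : 1 ≤ φ)
    (hLMI : ∃ (P : Matrix (Fin n) (Fin n) ℝ) (Λ Ξ : Fin M → Fin n → ℝ)
      (Υ : Fin (M + 1) → Fin (M + 1) → Fin n → ℝ) (Φ : Matrix (Fin n) (Fin n) ℝ) (ρ : ℝ),
      IsLMISolution Γ φ μ P Λ Ξ Υ Φ ρ)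
    (hcomplete : ForwardComplete U (identifiedField Γ f B)) :
    IsISS U (identifiedField Γ f B) := by
  obtain ⟨P, Λ, Ξ, Υ, Φ, ρ, h⟩ := hLMI
  obtain ⟨β, γ, hβ, hγ, hest⟩ := exists_iss_estimate_of_dissipation
    (h.isProperPosDef_lureFunction hf hgrowth) (h.isProperPosDef_dissipation hf hgrowth)
    (q := fun u : EuclideanSpace ℝ (Fin m) =>
      (B.mulVec u.ofLp) ⬝ᵥ Φ.mulVec (B.mulVec u.ofLp))
    (by fun_prop) (by simp)
  refine ⟨hcomplete, β, γ, hβ, hγ, fun x₀ u hu x hx t ht => ?_⟩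
  have := hest x u _ (inputSupNorm u)
    (fun t ht => (hx.deriv t ht).lureFunction_comp h.P_nonneg.isHermitian Λ hf.continuous)
    (fun t _ => h.lure_dissipation f B (x t) (u t)) (fun t ht => norm_le_inputSupNorm hu ht) t ht
  rwa [hx.init] at this
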